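/- Consider an $N\times N$ input-queued switch. The queue lengths $Q^t\in\mathbb{N}^{N\times N}$ evolve by $Q_{ij}^{t+1}=[Q_{ij}^t+A_{ij}^t-S_{ij}^t]^+$, where the schedule $S^t$ is a $0$-$1$ matrix with at most one $1$ in each row and each column. The arrivals are $A_{ij}^t=f(X_{ij}^t)$, where $f:\Omega\to\mathbb{N}$ for a finite set $\Omega$, and $\{X_{ij}^t\}_t$ are Markov chains on $\Omega$ that are independent across $(i,j)$. A (possibly randomized) Markovian scheduling algorithm draws $S^t$ from a law that depends on the current state $(Q^t,X^t)$ (for instance on $Q^t$ only); given the current state, the draw is independent of the transition of $X$. Thus $\{(Q^t,X^t)\}_t$ is a Markov chain. For each $\epsilon\in(0,1)$ let such arrivals be given (with the same $\Omega$ and $f$), such that the vector-valued chain $\{X^t\}^{(\epsilon)}$ on $\Omega^{N^2}$ is irreducible and aperiodic, and the stationary arrival rates are $\lambda^{(\epsilon)}=(1-\epsilon)v$, where $v_{ij}>0$ for all $i,j$ and all row sums and column sums of $v$ equal $1$. Let $$\gamma_{ij}^{(\epsilon)}(t)=E\big[(A_{ij}^t-\lambda^{(\epsilon)}_{ij})(A_{ij}^0-\lambda^{(\epsilon)}_{ij})\big]$$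 be the autocovariance of the stationary arrival process, and assume that $\lim_{\epsilon\to0}\gamma_{ij}^{(\epsilon)}(t)=\gamma_{ij}(t)$ exists for all $i,j$ and all $t\ge 0$. Assume also that the chains mix geometrically, uniformly in $\epsilon$: there are $\alpha\in(0,1)$ and $C>0$ such that, for all $\epsilon\in(0,1)$, all $i,j$, all $m\ge1$ and every initial law of $X_{ij}^0$, $$\big|E[f(X_{ij}^m)]-\lambda_{ij}^{(\epsilon)}\big|\le 2\,\big(\max_{\Omega} f\big)\,C\,\alpha^m .$$ For each $\epsilon\in(0,1)$ let a scheduling algorithm (the same for all $\epsilon$, or depending on $\epsilon$) be given under which the switch is stable, that is, the chain $\{(Q^t,X^t)\}^{(\epsilon)}$ is positive recurrent (it suffices that its initial state is a positive recurrent state), and let $(\overline{Q}^{(\epsilon)},\overline{X}^{(\epsilon)})$ be a steady-state random variable to which this chain converges in distribution. Then the limits $\sigma_{ij}^2=\gamma_{ij}(0)+2\lim_{m\to\infty}\sum_{t=1}^m\gamma_{ij}(t)$ exist and are nonnegative, and $$\liminf_{\epsilon\to0}\ \epsilon\,E\Big[\sum_{i,j}\overline{Q}_{ij}^{(\epsilon)}\Big]\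 \ge\ \frac{\|\sigma\|^2}{2},\qquad \|\sigma\|^2=\sum_{i,j}\sigma_{ij}^2,$$ where the expectation is allowed to be $+\infty$. -/

import Mathlib

open Filter Topology
open scoped ENNReal

noncomputable section

namespace MarkovSwitch

/-! ### Discrete-time Markov chains on a discrete state space

A time-homogeneous chain is given by its transition probabilities `P : S → PMF S`. -/

section Chains

variable {S : Type*}

/-- The law at time `n` of the chain with transition probabilities `P` and initial law `ν`. -/
def lawAt (P : S → PMF S) (ν : PMF S) : ℕ → PMF S
  | 0 => ν
  | n + 1 => (lawAt P ν n).bind P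

/-- Every state can be reached from every state. -/
def IsIrreducibleChain (P : S → PMF S) : Prop :=
  ∀ x y : S, ∃ n : ℕ, 0 < lawAt P (PMF.pure x) n y

/-- Every state has period one: the only common divisor of its possible return times is `1`. -/
def IsAperiodicChain (P : S → PMF S) : Prop :=
  ∀ x : S, ∀ d : ℕ, (∀ n : ℕ, 0 < n → 0 < lawAt P (PMF.pure x) n x → d ∣ n) → d = 1

/-- `π` is a stationary distribution of the chain. -/
def IsStationaryLaw (P : S → PMF S) (π : PMF S) : Prop :=
  π.bind P = π

open Classical in
/-- The probability that the chain started at `w` avoids the state `z` at the times `1, …, n`. -/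
def avoidProb (P : S → PMF S) (z : S) : ℕ → S → ℝ≥0∞
  | 0, _ => 1
  | n + 1, w => ∑' w' : S, if w' = z then 0 else P w w' * avoidProb P z n w'

/-- The state `z` is positive recurrent: its return time `T = inf {n ≥ 1 | Xⁿ = z}` for the chain
started at `z` has finite mean `E T = ∑ n ≥ 0, P (T > n)`. -/
def IsPositiveRecurrentAt (P : S → PMF S) (z : S) : Prop :=
  ∑' n : ℕ, avoidProb P z n z < ∞

/-- The chain started at `z` converges in distribution to the probability law `μ`
(on a discrete space this is pointwise convergence of the probabilities). -/
def ConvergesInLaw (P : S → PMF S) (z : S) (μ : PMF S) : Prop :=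
  ∀ w : S, Tendsto (fun n : ℕ => lawAt P (PMF.pure z) n w) atTop (𝓝 (μ w))

/-- The expectation of `g` under a probability law on a finite set. -/
def mean [Fintype S] (μ : PMF S) (g : S → ℝ) : ℝ :=
  ∑ x, (μ x).toReal * g x

/-- The autocovariance `E[(g(Xᵗ) - λ)(g(X⁰) - λ) | X⁰ ∼ π]`, where `λ = E[g(X) | X ∼ π]`. -/
def autocov [Fintype S] (P : S → PMF S) (π : PMF S) (g : S → ℝ) (t : ℕ) : ℝ :=
  ∑ x, ∑ y, (π x).toReal * (lawAt P (PMF.pure x) t y).toReal *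
    ((g y - mean π g) * (g x - mean π g))

/-- `α` and `C` are geometric mixing parameters for the observable `g ≥ 0` of the chain with
stationary law `π`: with `L = max g`, for every initial law and every `m ≥ 1`,
`|E[g(Xᵐ)] - λ| ≤ 2 L C αᵐ`. -/
def IsGeomMixing [Fintype S] (P : S → PMF S) (π : PMF S) (g : S → ℝ) (α C : ℝ) : Prop :=
  ∀ ν : PMF S, ∀ m : ℕ, 1 ≤ m →
    |mean (lawAt P ν m) g - mean π g| ≤ 2 * (⨆ x, g x) * C * α ^ m

end Chains

/-- The law of independent coordinates with given marginals. -/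
def productLaw {ι Ω : Type*} [Fintype ι] [DecidableEq ι] [Fintype Ω] (μ : ι → PMF Ω) :
    PMF (ι → Ω) :=
  PMF.ofFintype (fun x => ∏ i, μ i (x i)) (by
    have h := Finset.prod_univ_sum (fun _ : ι => (Finset.univ : Finset Ω)) (fun i a => μ i a)
    rw [Fintype.piFinset_univ] at h
    rw [← h]
    refine Finset.prod_eq_one fun i _ => ?_
    rw [← tsum_fintype (L := SummationFilter.unconditional Ω)]
    exact (μ i).tsum_coe)

/-! ### The input queued switch -/

section Switch

variable {N : ℕ} {Ω : Type*} [Fintype Ω]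

/-- Input-output pairs of an `N × N` switch. -/
abbrev Pair (N : ℕ) : Type := Fin N × Fin N

/-- Feasible schedules: `0`-`1` matrices with at most one service in each row and column. -/
def Schedule (N : ℕ) : Type :=
  {s : Pair N → ℕ // (∀ p, s p = 0 ∨ s p = 1) ∧ (∀ i, ∑ j, s (i, j) ≤ 1) ∧
    (∀ j, ∑ i, s (i, j) ≤ 1)}

/-- States `(q, x)`: queue lengths and the state of the modulating chain. -/
abbrev State (N : ℕ) (Ω : Type*) : Type _ := (Pair N → ℕ) × (Pair N → Ω)

/-- A (possibly randomized) Markovian scheduling algorithm: the conditional law of the schedule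
given the current state. -/
abbrev Scheduler (N : ℕ) (Ω : Type*) : Type _ := State N Ω → PMF (Schedule N)

/-- The vector-valued modulating chain: the coordinates move independently, coordinate `p`
according to `P p`. -/
def modulatingChain (P : Pair N → Ω → PMF Ω) (x : Pair N → Ω) : PMF (Pair N → Ω) :=
  productLaw fun p => P p (x p)

/-- Queue lengths after one time slot, `[q + a - s]⁺` (truncated subtraction). -/
def nextQueue (f : Ω → ℕ) (q : Pair N → ℕ) (x : Pair N → Ω) (s : Schedule N) : Pair N → ℕ :=
  fun p => q p + f (x p) - s.1 p

/-- The chain `(Qᵗ, Xᵗ)`: in state `(q, x)` a schedule `s` is drawn from the algorithm, the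
arrivals are `f (x p)`, and independently the modulating chain moves. -/
def switchChain (P : Pair N → Ω → PMF Ω) (f : Ω → ℕ) (alg : Scheduler N Ω) (z : State N Ω) :
    PMF (State N Ω) :=
  (alg z).bind fun s =>
    (modulatingChain P z.2).map fun x' => (nextQueue f z.1 z.2 s, x')

/-- The expected total queue length `E[∑ Q̄]`, in `[0, ∞]`, when `(Q̄, X̄)` has law `μ`. -/
def meanTotalQueue (μ : PMF (State N Ω)) : ℝ≥0∞ :=
  ∑' z : State N Ω, μ z * ((∑ p, z.1 p : ℕ) : ℝ≥0∞)

end Switch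

end MarkovSwitch

end

/-!
The queues of one input port `i` form a single queue `W = ∑ⱼ Qᵢⱼ` which receives the arrivals
`∑ⱼ f (xᵢⱼ)`, of mean `1 - ε`, and is served at most once per time slot. Hence
`W' = W + G - ε + u`, where `G` is the centered arrival and the unused service `u` lies in `[0, 1]`.
In steady state `E[u] = ε`, and `E[W'² - W²] = 0` yields, because `u W' ≥ 0`,
`2 ε E[W] ≥ E[G²] + 2 E[W G] - O(ε)`. The last identity needs no second moment of `W`: the increment
`W'² - W²` is integrable as soon as `W` is, and an integrable difference of two equidistributed
variables has mean zero (`integral_sub_eq_zero_of_identDistrib`).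

The correlation `E[W G]` is computed with the Poisson equation. Let `K` be the sum of the expected
future values of `G` (`futureBias`); it is bounded uniformly in `ε` by geometric mixing, and
`E[(G + K)(X') | X] = K(X)`. Stationarity of `W (G + K)` gives `E[W G] = E[(W' - W) K]`, which is
`E[G K] + O(ε)`. So `2 ε E[W] ≥ E[G² + 2 G K] - O(ε)`
(`integral_sq_add_le_of_stationary_queue`, `sum_asymptoticVariance_le`).

A limit law of the chain is stationary (`ConvergesInLaw.isStationaryLaw`), and an irreducible finite
chain has a unique stationary law (`IsStationaryLaw.unique`), so in steady state the modulating
chain has independent coordinates and `E[G² + 2 G K]` is the sum over `j` of the asymptotic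
variances `γᵢⱼ(0) + 2 ∑_{t ≥ 1} γᵢⱼ(t)`. These are nonnegative by Jensen's inequality
(`asymptoticVariance_nonneg`), and they converge as `ε → 0` by dominated convergence
(`tendsto_asymptoticVariance`). Summing over the ports gives the bound.
-/

namespace MarkovSwitch

/-! ### Expectations under probability mass functions on a finite set -/

section Mean

variable {S T : Type*} [Fintype S]

lemma sum_toReal_eq_one (μ : PMF S) : ∑ x, (μ x).toReal = 1 := by
  rw [← ENNReal.toReal_sum fun x _ => μ.apply_ne_top x, ← tsum_fintype (L := .unconditional S),
    μ.tsum_coe, ENNReal.toReal_one]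

lemma mean_eq_sum (μ : PMF S) (g : S → ℝ) : mean μ g = ∑ x, (μ x).toReal * g x := rfl

lemma mean_const (μ : PMF S) (c : ℝ) : mean μ (fun _ => c) = c := by
  simp [mean, ← Finset.sum_mul, sum_toReal_eq_one]

lemma mean_add (μ : PMF S) (g h : S → ℝ) :
    mean μ (fun x => g x + h x) = mean μ g + mean μ h := by
  simp [mean, mul_add, Finset.sum_add_distrib]

lemma mean_sub (μ : PMF S) (g h : S → ℝ) :
    mean μ (fun x => g x - h x) = mean μ g - mean μ h := by
  simp [mean, mul_sub, Finset.sum_sub_distrib]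

lemma mean_const_mul (μ : PMF S) (c : ℝ) (g : S → ℝ) :
    mean μ (fun x => c * g x) = c * mean μ g := by
  simp only [mean, Finset.mul_sum]
  exact Finset.sum_congr rfl fun _ _ => by ring

lemma mean_sum {ι : Type*} (μ : PMF S) (s : Finset ι) (g : ι → S → ℝ) :
    mean μ (fun x => ∑ j ∈ s, g j x) = ∑ j ∈ s, mean μ (g j) := by
  simp only [mean, Finset.mul_sum]
  exact Finset.sum_comm

lemma mean_tsum (μ : PMF S) {u : ℕ → S → ℝ} (hu : ∀ x, Summable fun t => u t x) :
    mean μ (fun x => ∑' t, u t x) = ∑' t, mean μ (u t) := by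
  simp only [mean, ← tsum_mul_left]
  exact (Summable.tsum_finsetSum fun x _ => (hu x).mul_left _).symm

lemma mean_mono (μ : PMF S) {g h : S → ℝ} (hgh : ∀ x, g x ≤ h x) : mean μ g ≤ mean μ h :=
  Finset.sum_le_sum fun x _ => mul_le_mul_of_nonneg_left (hgh x) ENNReal.toReal_nonneg

lemma abs_mean_le (μ : PMF S) {g : S → ℝ} {c : ℝ} (hg : ∀ x, |g x| ≤ c) : |mean μ g| ≤ c := by
  rw [abs_le]
  constructor
  · simpa [mean_const] using mean_mono μ (g := fun _ => -c) fun x => (abs_le.1 (hg x)).1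
  · simpa [mean_const] using mean_mono μ (h := fun _ => c) fun x => (abs_le.1 (hg x)).2

lemma toReal_bind_apply (μ : PMF S) (κ : S → PMF T) (y : T) :
    (μ.bind κ y).toReal = ∑ x, (μ x).toReal * (κ x y).toReal := by
  rw [PMF.bind_apply, tsum_fintype, ENNReal.toReal_sum fun x _ =>
    ENNReal.mul_ne_top (μ.apply_ne_top x) ((κ x).apply_ne_top y)]
  simp [ENNReal.toReal_mul]

lemma mean_bind [Fintype T] (μ : PMF S) (κ : S → PMF T) (g : T → ℝ) :
    mean (μ.bind κ) g = mean μ (fun x => mean (κ x) g) := by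
  simp only [mean, toReal_bind_apply, Finset.sum_mul, Finset.mul_sum]
  rw [Finset.sum_comm]
  exact Finset.sum_congr rfl fun _ _ => Finset.sum_congr rfl fun _ _ => by ring

lemma mean_pure (x : S) (g : S → ℝ) : mean (PMF.pure x) g = g x := by
  classical
  simp [mean, PMF.pure_apply, apply_ite ENNReal.toReal]

lemma sq_mean_le_mean_sq (μ : PMF S) (g : S → ℝ) : mean μ g ^ 2 ≤ mean μ (fun x => g x ^ 2) := by
  have h : 0 ≤ mean μ (fun x => (g x - mean μ g) ^ 2) :=
    Finset.sum_nonneg fun x _ => mul_nonneg ENNReal.toReal_nonneg (sq_nonneg _)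
  have e : mean μ (fun x => (g x - mean μ g) ^ 2) =
      mean μ (fun x => g x ^ 2) - mean μ g ^ 2 := by
    have : (fun x => (g x - mean μ g) ^ 2) =
        fun x => (g x ^ 2 - (2 * mean μ g) * g x) + mean μ g ^ 2 := by
      funext x; ring
    rw [this, mean_add, mean_sub, mean_const_mul, mean_const]
    ring
  linarith

end Mean

/-! ### Laws of Markov chains -/

section Laws

variable {S : Type*}

lemma lawAt_succ' (P : S → PMF S) (ν : PMF S) (n : ℕ) :
    lawAt P ν (n + 1) = lawAt P (ν.bind P) n := by
  induction n with
  | zero => rfl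
  | succ n ih => exact congrArg (fun q : PMF S => q.bind P) ih

lemma lawAt_eq_bind (P : S → PMF S) (ν : PMF S) (n : ℕ) :
    lawAt P ν n = ν.bind fun x => lawAt P (PMF.pure x) n := by
  induction n with
  | zero => exact (PMF.bind_pure ν).symm
  | succ n ih => simp only [lawAt, ih, PMF.bind_bind]

lemma IsStationaryLaw.lawAt_eq {P : S → PMF S} {π : PMF S} (h : IsStationaryLaw P π) (n : ℕ) :
    lawAt P π n = π := by
  induction n with
  | zero => rfl
  | succ n ih => exact (congrArg (fun q : PMF S => q.bind P) ih).trans h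

/-- A probability law that is a pointwise limit of the laws of a chain is stationary: by Fatou
its image under a step of the chain is pointwise at most itself, and both have mass one. -/
lemma ConvergesInLaw.isStationaryLaw {P : S → PMF S} {z : S} {μ : PMF S}
    (h : ConvergesInLaw P z μ) : IsStationaryLaw P μ := by
  have hle : ∀ w, μ.bind P w ≤ μ w := by
    intro w
    let _ : MeasurableSpace S := ⊤
    have key := MeasureTheory.lintegral_liminf_le (μ := MeasureTheory.Measure.count)
      (u := (atTop : Filter ℕ)) (f := fun n y => lawAt P (PMF.pure z) n y * P y w)
      (fun n => measurable_from_top)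
    simp only [MeasureTheory.lintegral_count] at key
    have h1 : ∀ y, liminf (fun n => lawAt P (PMF.pure z) n y * P y w) atTop = μ y * P y w :=
      fun y => (ENNReal.Tendsto.mul_const (h y) (Or.inr ((P y).apply_ne_top w))).liminf_eq
    have h2 : liminf (fun n => ∑' y, lawAt P (PMF.pure z) n y * P y w) atTop = μ w :=
      ((tendsto_add_atTop_iff_nat 1).2 (h w)).liminf_eq
    simp only [h1, h2] at key
    rwa [PMF.bind_apply]
  refine PMF.ext fun w => le_antisymm (hle w) ?_
  by_contra hlt
  have := ENNReal.tsum_lt_tsum (by rw [PMF.tsum_coe]; exact ENNReal.one_ne_top) hle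
    (not_le.1 hlt)
  rw [PMF.tsum_coe, PMF.tsum_coe] at this
  exact lt_irrefl _ this

/-- An irreducible chain on a finite set has at most one stationary law: subtracting from one
stationary law the largest multiple of another that lies below it leaves a nonnegative stationary
vector with a zero, and irreducibility spreads that zero to every state. -/
lemma IsStationaryLaw.unique [Fintype S] {P : S → PMF S} (hP : IsIrreducibleChain P)
    {π ρ : PMF S} (hπ : IsStationaryLaw P π) (hρ : IsStationaryLaw P ρ) : π = ρ := by
  classical
  have hne : Nonempty S := ⟨π.support_nonempty.some⟩
  have flow : ∀ {τ : PMF S}, IsStationaryLaw P τ → ∀ n y,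
      (τ y).toReal = ∑ x, (τ x).toReal * (lawAt P (PMF.pure x) n y).toReal := by
    intro τ hτ n y
    rw [← toReal_bind_apply, ← lawAt_eq_bind, hτ.lawAt_eq]
  have hpos : ∀ y, 0 < (ρ y).toReal := by
    intro y
    obtain ⟨x, hx⟩ := ρ.support_nonempty
    obtain ⟨n, hn⟩ := hP x y
    rw [flow hρ n y]
    refine Finset.sum_pos' (fun _ _ => by positivity) ⟨x, Finset.mem_univ x, ?_⟩
    exact mul_pos (ENNReal.toReal_pos hx (ρ.apply_ne_top x))
      (ENNReal.toReal_pos hn.ne' (PMF.apply_ne_top _ y))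
  obtain ⟨x₀, hx₀⟩ := Finite.exists_min fun x => (π x).toReal / (ρ x).toReal
  set c := (π x₀).toReal / (ρ x₀).toReal with hc
  have hD : ∀ x, 0 ≤ (π x).toReal - c * (ρ x).toReal := by
    intro x
    have := (le_div_iff₀ (hpos x)).1 (hx₀ x)
    linarith
  have hD0 : (π x₀).toReal - c * (ρ x₀).toReal = 0 := by
    rw [hc, div_mul_cancel₀ _ (hpos x₀).ne', sub_self]
  have hall : ∀ x, (π x).toReal = c * (ρ x).toReal := by
    intro x
    obtain ⟨n, hn⟩ := hP x x₀
    have hsum : ∑ y, ((π y).toReal - c * (ρ y).toReal) *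
        (lawAt P (PMF.pure y) n x₀).toReal = 0 := by
      rw [← hD0, flow hπ n x₀, flow hρ n x₀, Finset.mul_sum, ← Finset.sum_sub_distrib]
      exact Finset.sum_congr rfl fun _ _ => by ring
    have h0 := (Finset.sum_eq_zero_iff_of_nonneg fun y _ =>
      mul_nonneg (hD y) ENNReal.toReal_nonneg).1 hsum x (Finset.mem_univ x)
    have hn' := (ENNReal.toReal_pos hn.ne' (PMF.apply_ne_top _ x₀)).ne'
    linarith [(mul_eq_zero.1 h0).resolve_right hn']
  have hc1 : c = 1 := by
    have := sum_toReal_eq_one π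
    simp only [hall, ← Finset.mul_sum, sum_toReal_eq_one, mul_one] at this
    exact this
  refine PMF.ext fun x => (ENNReal.toReal_eq_toReal_iff' (π.apply_ne_top x) (ρ.apply_ne_top x)).1 ?_
  rw [hall x, hc1, one_mul]

end Laws

/-! ### Product laws -/

section Product

variable {ι Ω : Type*} [Fintype ι] [DecidableEq ι] [Fintype Ω]

lemma productLaw_apply (μ : ι → PMF Ω) (x : ι → Ω) : productLaw μ x = ∏ i, μ i (x i) := rfl

lemma mean_productLaw_prod (μ : ι → PMF Ω) (φ : ι → Ω → ℝ) :
    mean (productLaw μ) (fun x => ∏ i, φ i (x i)) = ∏ i, mean (μ i) (φ i) := by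
  simp only [mean, productLaw_apply, ENNReal.toReal_prod, ← Finset.prod_mul_distrib]
  rw [Finset.prod_univ_sum, Fintype.piFinset_univ]

lemma mean_productLaw_apply (μ : ι → PMF Ω) (i : ι) (φ : Ω → ℝ) :
    mean (productLaw μ) (fun x => φ (x i)) = mean (μ i) φ := by
  have h := mean_productLaw_prod μ fun k a => if k = i then φ a else 1
  have e : ∀ k, mean (μ k) (fun a => if k = i then φ a else 1) =
      if k = i then mean (μ k) φ else 1 := by
    intro k
    split_ifs
    · rfl
    · exact mean_const _ _
  simpa [e] using h

lemma mean_productLaw_mul (μ : ι → PMF Ω) {i j : ι} (hij : i ≠ j) (φ ψ : Ω → ℝ) :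
    mean (productLaw μ) (fun x => φ (x i) * ψ (x j)) = mean (μ i) φ * mean (μ j) ψ := by
  have h := mean_productLaw_prod μ
    fun k a => (if k = i then φ a else 1) * (if k = j then ψ a else 1)
  have e : ∀ k, mean (μ k) (fun a => (if k = i then φ a else 1) * (if k = j then ψ a else 1)) =
      (if k = i then mean (μ k) φ else 1) * (if k = j then mean (μ k) ψ else 1) := by
    intro k
    by_cases h1 : k = i
    · have h2 : k ≠ j := fun h => hij (h1.symm.trans h)
      simp [h1, hij]
    · by_cases h2 : k = j
      · simp [h2, Ne.symm hij]
      · simp [h1, h2, mean_const]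
  simp only [e, Finset.prod_mul_distrib, Finset.prod_ite_eq', Finset.mem_univ, if_true] at h
  exact h

lemma isStationaryLaw_productLaw {N : ℕ} {P : Pair N → Ω → PMF Ω} {π : Pair N → PMF Ω}
    (h : ∀ p, IsStationaryLaw (P p) (π p)) :
    IsStationaryLaw (modulatingChain P) (productLaw π) := by
  refine PMF.ext fun y => ?_
  have e : ∀ p, ∑ a, π p a * P p a (y p) = π p (y p) := fun p => by
    rw [← tsum_fintype (L := .unconditional Ω), ← PMF.bind_apply, h p]
  rw [PMF.bind_apply, tsum_fintype]
  simp only [modulatingChain, productLaw_apply, ← Finset.prod_mul_distrib, ← e]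
  rw [Finset.prod_univ_sum, Fintype.piFinset_univ]

end Product

/-! ### The Poisson equation and the asymptotic variance -/

section Poisson

variable {S : Type*} [Fintype S] {P : S → PMF S} {π : PMF S} {g : S → ℝ} {α c : ℝ}

/-- The sum `∑_{t ≥ 1} (E[g(Xᵗ) | X⁰ = x] - λ)` of the future biases of the observable `g`. Adding
the present bias `g - λ` gives the solution of the Poisson equation for `g`. -/
noncomputable def futureBias (P : S → PMF S) (π : PMF S) (g : S → ℝ) (x : S) : ℝ :=
  ∑' t : ℕ, (mean (lawAt P (PMF.pure x) (t + 1)) g - mean π g)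

/-- The asymptotic variance `E_π[(g - λ)² + 2 (g - λ) k]`, with `k` the future bias of `g`. -/
noncomputable def asymptoticVariance (P : S → PMF S) (π : PMF S) (g : S → ℝ) : ℝ :=
  mean π fun x => (g x - mean π g) ^ 2 + 2 * ((g x - mean π g) * futureBias P π g x)

/-- Geometric decay, at rate `α`, of the bias of `g` along the chain started from any state. Time is
shifted by one: nothing is asked of the initial bias, and `c` bounds the bias after one step. -/
def HasBiasDecay (P : S → PMF S) (π : PMF S) (g : S → ℝ) (c α : ℝ) : Prop :=
  ∀ x t, |mean (lawAt P (PMF.pure x) (t + 1)) g - mean π g| ≤ c * α ^ t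

lemma summable_geometric_bound (hα : 0 ≤ α) (hα' : α < 1) :
    Summable fun t : ℕ => c * α ^ t :=
  (summable_geometric_of_lt_one hα hα').mul_left c

namespace HasBiasDecay

lemma summable (h : HasBiasDecay P π g c α) (hα : 0 ≤ α) (hα' : α < 1) (x : S) :
    Summable fun t : ℕ => mean (lawAt P (PMF.pure x) (t + 1)) g - mean π g :=
  Summable.of_norm_bounded (summable_geometric_bound hα hα') (h x)

lemma abs_futureBias_le (h : HasBiasDecay P π g c α) (hα : 0 ≤ α) (hα' : α < 1) (x : S) :
    |futureBias P π g x| ≤ c * (1 - α)⁻¹ :=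
  tsum_of_norm_bounded (f := fun t : ℕ => mean (lawAt P (PMF.pure x) (t + 1)) g - mean π g)
    ((hasSum_geometric_of_lt_one hα hα').mul_left c) (h x)

/-- The Poisson equation. -/
lemma mean_add_futureBias (h : HasBiasDecay P π g c α) (hα : 0 ≤ α) (hα' : α < 1) (x : S) :
    mean (P x) (fun y => (g y - mean π g) + futureBias P π g y) = futureBias P π g x := by
  have h1 : ∀ t, mean (P x) (fun y => mean (lawAt P (PMF.pure y) t) g) =
      mean (lawAt P (PMF.pure x) (t + 1)) g := by
    intro t
    rw [← mean_bind, ← lawAt_eq_bind, lawAt_succ', PMF.pure_bind]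
  have h2 : mean (P x) (futureBias P π g) =
      ∑' t : ℕ, (mean (lawAt P (PMF.pure x) (t + 1 + 1)) g - mean π g) := by
    unfold futureBias
    rw [mean_tsum _ (h.summable hα hα')]
    exact tsum_congr fun t => by rw [mean_sub, mean_const, h1]
  rw [mean_add, mean_sub, mean_const, h2, futureBias, (h.summable hα hα' x).tsum_eq_zero_add,
    ← h1 0]
  simp [lawAt, mean_pure]

end HasBiasDecay

lemma autocov_eq (t : ℕ) : autocov P π g t =
    mean π fun x => (g x - mean π g) * (mean (lawAt P (PMF.pure x) t) g - mean π g) := by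
  refine Finset.sum_congr rfl fun x _ => ?_
  have e : mean (lawAt P (PMF.pure x) t) g - mean π g =
      ∑ y, (lawAt P (PMF.pure x) t y).toReal * (g y - mean π g) := by
    rw [← mean_eq_sum, mean_sub, mean_const]
  simp only [e, Finset.mul_sum]
  exact Finset.sum_congr rfl fun y _ => by ring

lemma abs_autocov_succ_le (h : HasBiasDecay P π g c α) {L : ℝ} (hL : ∀ x, |g x - mean π g| ≤ L)
    (t : ℕ) : |autocov P π g (t + 1)| ≤ L * c * α ^ t := by
  rw [autocov_eq]
  refine abs_mean_le π fun x => ?_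
  rw [abs_mul, mul_assoc]
  exact mul_le_mul (hL x) (h x t) (abs_nonneg _) ((abs_nonneg _).trans (hL x))

lemma asymptoticVariance_eq (h : HasBiasDecay P π g c α) (hα : 0 ≤ α) (hα' : α < 1) :
    asymptoticVariance P π g = autocov P π g 0 + 2 * ∑' t : ℕ, autocov P π g (t + 1) := by
  have h1 : ∑' t : ℕ, autocov P π g (t + 1) =
      mean π fun x => (g x - mean π g) * futureBias P π g x := by
    simp only [autocov_eq, futureBias, ← tsum_mul_left]
    exact (mean_tsum π fun x => (h.summable hα hα' x).mul_left _).symm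
  rw [h1, asymptoticVariance, mean_add, mean_const_mul, autocov_eq]
  simp [lawAt, mean_pure, sq]

/-- With `h` the solution of the Poisson equation, the asymptotic variance is
`E_π[h²] - E_π[(P h)²]`, which is nonnegative by Jensen's inequality. -/
lemma asymptoticVariance_nonneg (h : HasBiasDecay P π g c α) (hα : 0 ≤ α) (hα' : α < 1)
    (hπ : IsStationaryLaw P π) : 0 ≤ asymptoticVariance P π g := by
  have h1 : mean π (fun x => futureBias P π g x ^ 2) ≤
      mean π (fun y => ((g y - mean π g) + futureBias P π g y) ^ 2) := by
    conv_rhs => rw [← hπ, mean_bind, hπ]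
    refine mean_mono π fun x => ?_
    rw [← h.mean_add_futureBias hα hα' x]
    exact sq_mean_le_mean_sq _ _
  have h2 : asymptoticVariance P π g =
      mean π (fun y => ((g y - mean π g) + futureBias P π g y) ^ 2) -
        mean π (fun x => futureBias P π g x ^ 2) := by
    rw [asymptoticVariance, ← mean_sub]
    congr 1
    funext x
    ring
  linarith

lemma IsGeomMixing.hasBiasDecay {C : ℝ} (h : IsGeomMixing P π g α C) :
    HasBiasDecay P π g (2 * (⨆ x, g x) * C * α) α := fun x t => by
  have := h (PMF.pure x) (t + 1) (Nat.le_add_left 1 t)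
  rwa [pow_succ', ← mul_assoc] at this

end Poisson

/-! ### The drift inequality for a queue in steady state -/

section Drift

open MeasureTheory ProbabilityTheory

variable {T : Type*} [MeasurableSpace T] {ρ : Measure T} [IsProbabilityMeasure ρ]

/-- If `X` and `Y` have the same law and `Y - X` is integrable, then `Y - X` has mean zero, even
if `X` itself is not integrable. -/
lemma integral_sub_eq_zero_of_identDistrib {X Y : T → ℝ} (h : IdentDistrib X Y ρ ρ)
    (hi : Integrable (fun a => Y a - X a) ρ) : ∫ a, (Y a - X a) ∂ρ = 0 := by
  -- Truncation at height `n` contracts distances, so dominated convergence applies.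
  let φ : ℕ → ℝ → ℝ := fun n r => min r n ⊔ (-(n : ℝ))
  have hφm : ∀ n, Measurable (φ n) := fun n => by fun_prop
  have hφb : ∀ n r, ‖φ n r‖ ≤ n := by
    intro n r
    rw [Real.norm_eq_abs, abs_le]
    exact ⟨le_sup_right, sup_le (min_le_right _ _) (by linarith [n.cast_nonneg (α := ℝ)])⟩
  have hφl : ∀ n r s, |φ n r - φ n s| ≤ |r - s| := fun n r s =>
    (abs_sup_sub_sup_le_abs _ _ _).trans (abs_inf_sub_inf_le_abs _ _ _)
  have hφt : ∀ r, Tendsto (fun n => φ n r) atTop (𝓝 r) := by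
    intro r
    refine tendsto_const_nhds.congr' ?_
    obtain ⟨m, hm⟩ := exists_nat_ge |r|
    filter_upwards [eventually_ge_atTop m] with n hn
    have hn' : |r| ≤ n := hm.trans (Nat.cast_le.2 hn)
    have := abs_le.1 hn'
    simp only [φ]
    rw [min_eq_left this.2, sup_eq_left.2 this.1]
  have hX := h.aemeasurable_fst
  have hY := h.aemeasurable_snd
  have hiφ : ∀ n {Z : T → ℝ}, AEMeasurable Z ρ → Integrable (fun a => φ n (Z a)) ρ :=
    fun n Z hZ => Integrable.of_bound ((hφm n).comp_aemeasurable hZ).aestronglyMeasurable (n : ℝ)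
      (Eventually.of_forall fun a => hφb n _)
  have hlim : Tendsto (fun n => ∫ a, (φ n (Y a) - φ n (X a)) ∂ρ) atTop
      (𝓝 (∫ a, (Y a - X a) ∂ρ)) := by
    refine tendsto_integral_of_dominated_convergence (fun a => |Y a - X a|)
      (fun n => ((hiφ n hY).sub (hiφ n hX)).aestronglyMeasurable) hi.abs
      (fun n => Eventually.of_forall fun a => hφl n _ _)
      (Eventually.of_forall fun a => (hφt _).sub (hφt _))
  refine tendsto_nhds_unique hlim ?_
  have : ∀ n, ∫ a, (φ n (Y a) - φ n (X a)) ∂ρ = 0 := fun n => by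
    rw [integral_sub (hiφ n hY) (hiφ n hX), sub_eq_zero]
    exact (h.comp (hφm n)).integral_eq.symm
  simp [this]

/-- Let `W` and `W'` be the consecutive lengths of a queue in steady state, `G - ε` the arrivals
minus the capacity one, and `K` a bounded corrector which turns the correlation of `W` with `G`
into that of `W' - W` with `K`. Then `E[G² + 2 G K]` bounds `2 ε E[W]` from below, up to `O(ε)`. -/
lemma integral_sq_add_le_of_stationary_queue {W W' G K : T → ℝ} {ε B D : ℝ}
    (hG : Measurable G) (hK : Measurable K) (hε : 0 ≤ ε)
    (hWW' : IdentDistrib W W' ρ ρ) (hWi : Integrable W ρ) (hW' : ∀ a, 0 ≤ W' a)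
    (hlow : ∀ a, W a + G a - ε ≤ W' a) (hupp : ∀ a, W' a ≤ W a + G a - ε + 1)
    (hGD : ∀ a, |G a| ≤ D) (hKB : ∀ a, |K a| ≤ B) (hGm : ∫ a, G a ∂ρ = 0)
    (hcorr : ∫ a, W' a * K a ∂ρ = ∫ a, W a * (G a + K a) ∂ρ) :
    ∫ a, (G a ^ 2 + 2 * (G a * K a)) ∂ρ ≤ 2 * ε * ∫ a, W a ∂ρ + ε * (1 + 4 * B) := by
  have hW'i : Integrable W' ρ := hWW'.integrable_iff.1 hWi
  have hGi : Integrable G ρ :=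
    .of_bound hG.aestronglyMeasurable D (Eventually.of_forall hGD)
  have hWGK : Integrable (fun a => W a * (G a + K a)) ρ :=
    hWi.mul_bdd (c := D + B) (hG.add hK).aestronglyMeasurable
      (Eventually.of_forall fun a => (abs_add_le _ _).trans (add_le_add (hGD a) (hKB a)))
  have hW'K : Integrable (fun a => W' a * K a) ρ :=
    hW'i.mul_bdd (c := B) hK.aestronglyMeasurable (Eventually.of_forall hKB)
  have hGK : Integrable (fun a => G a ^ 2 + 2 * (G a * K a)) ρ := by
    have h1 : Integrable (fun a => G a * G a) ρ :=
      hGi.mul_bdd (c := D) hG.aestronglyMeasurable (Eventually.of_forall hGD)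
    have h2 : Integrable (fun a => G a * K a) ρ :=
      hGi.mul_bdd (c := B) hK.aestronglyMeasurable (Eventually.of_forall hKB)
    simp only [sq]
    exact h1.add (h2.const_mul 2)
  have hsq : Integrable (fun a => W' a ^ 2 - W a ^ 2) ρ := by
    have h1 : Integrable (fun a => (W' a + W a) * (W' a - W a)) ρ := by
      refine (hW'i.add hWi).mul_bdd (c := D + ε + 1) (hW'i.sub hWi).aestronglyMeasurable
        (Eventually.of_forall fun a => ?_)
      have := abs_le.1 (hGD a)
      rw [Real.norm_eq_abs, abs_le]
      constructor <;> linarith [hlow a, hupp a]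
    refine h1.congr (Eventually.of_forall fun a => ?_)
    change (W' a + W a) * (W' a - W a) = W' a ^ 2 - W a ^ 2
    ring
  have hsq0 := integral_sub_eq_zero_of_identDistrib hWW'.sq hsq
  have hlin0 := integral_sub_eq_zero_of_identDistrib hWW' (hW'i.sub hWi)
  -- The unused service `u = W' - (W + G - ε)` lies in `[0, 1]` and has mean `ε`.
  have hpt : ∀ a, G a ^ 2 + 2 * (G a * K a) ≤
      (W' a ^ 2 - W a ^ 2) + 2 * (W' a * K a - W a * (G a + K a)) +
        (1 + 2 * B) * (W' a - W a) + (2 * ε - (1 + 2 * B)) * G a + 2 * ε * W a +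
          ε * (1 + 4 * B) := by
    intro a
    obtain ⟨u, hu⟩ : ∃ u, u = W' a - (W a + G a - ε) := ⟨_, rfl⟩
    have hu0 : 0 ≤ u := by linarith [hlow a]
    have hu1 : u ≤ 1 := by linarith [hupp a]
    have hk := abs_le.1 (hKB a)
    have h1 : -(u + ε) * B ≤ (u - ε) * K a := by
      nlinarith [mul_nonneg hu0 (by linarith : 0 ≤ B + K a),
        mul_nonneg hε (by linarith : 0 ≤ B - K a)]
    have h2 : 0 ≤ 2 * (u * W' a) + (u - u ^ 2) := by
      nlinarith [mul_nonneg hu0 (hW' a), mul_nonneg hu0 (by linarith : 0 ≤ 1 - u)]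
    have hW : W a = W' a - u - G a + ε := by linarith
    rw [hW]
    nlinarith [sq_nonneg ε]
  have i1 : Integrable (fun a => 2 * (W' a * K a - W a * (G a + K a))) ρ :=
    (hW'K.sub hWGK).const_mul 2
  have i2 : Integrable (fun a => (1 + 2 * B) * (W' a - W a)) ρ := (hW'i.sub hWi).const_mul _
  have i3 := hGi.const_mul (2 * ε - (1 + 2 * B))
  have i4 := hWi.const_mul (2 * ε)
  have i5 := integrable_const (μ := ρ) (ε * (1 + 4 * B))
  refine (integral_mono hGK (((((hsq.add i1).add i2).add i3).add i4).add i5) hpt).trans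
    (le_of_eq ?_)
  rw [integral_add' ((((hsq.add i1).add i2).add i3).add i4) i5,
    integral_add' (((hsq.add i1).add i2).add i3) i4, integral_add' ((hsq.add i1).add i2) i3,
    integral_add' (hsq.add i1) i2, integral_add' hsq i1, integral_const_mul, integral_const_mul,
    integral_const_mul, integral_const_mul, hsq0, hlin0, hGm, integral_sub hW'K hWGK, hcorr]
  simp

end Drift

/-! ### One step of a chain as a joint law -/

section Joint

open MeasureTheory

variable {S T : Type*}

/-- The joint law of a variable with law `p` and of a variable drawn from `κ` given the first. -/
noncomputable def jointLaw (p : PMF S) (κ : S → PMF T) : PMF (S × T) :=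
  p.bind fun a => (κ a).map (Prod.mk a)

lemma jointLaw_apply (p : PMF S) (κ : S → PMF T) (a : S) (b : T) :
    jointLaw p κ (a, b) = p a * κ a b := by
  classical
  rw [jointLaw, PMF.bind_apply, tsum_eq_single a]
  · rw [PMF.map_apply, tsum_eq_single b]
    · simp
    · intro b' hb
      simp [Ne.symm hb]
  · intro a' ha
    rw [PMF.map_apply]
    simp [Ne.symm ha]

lemma jointLaw_map_fst (p : PMF S) (κ : S → PMF T) : (jointLaw p κ).map Prod.fst = p := by
  rw [jointLaw, PMF.map_bind]
  have : ∀ a, ((κ a).map (Prod.mk a)).map Prod.fst = PMF.pure a := fun a => by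
    rw [PMF.map_comp]
    exact PMF.map_const _ _
  simp only [this, PMF.bind_pure]

lemma summable_of_integrable_toMeasure [Countable S] [MeasurableSpace S]
    [MeasurableSingletonClass S] {p : PMF S} {F : S → ℝ} (hF : Integrable F p.toMeasure) :
    Summable fun a => (p a).toReal * F a := by
  have h := hF.hasFiniteIntegral
  rw [HasFiniteIntegral, lintegral_countable'] at h
  refine Summable.of_norm ((ENNReal.summable_toReal h.ne).congr fun a => ?_)
  rw [PMF.toMeasure_apply_singleton _ _ (measurableSet_singleton a), ENNReal.toReal_mul,
    toReal_enorm, norm_mul, Real.norm_of_nonneg ENNReal.toReal_nonneg, mul_comm]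

variable [Countable S] [MeasurableSpace S] [MeasurableSingletonClass S]
  [Fintype T] [MeasurableSpace T] [MeasurableSingletonClass T]

lemma integral_jointLaw {p : PMF S} {κ : S → PMF T} {F : S × T → ℝ}
    (hF : Integrable F (jointLaw p κ).toMeasure) :
    ∫ c, F c ∂(jointLaw p κ).toMeasure =
      ∑' a, (p a).toReal * mean (κ a) (fun b => F (a, b)) := by
  have hs := summable_of_integrable_toMeasure hF
  rw [PMF.integral_eq_tsum _ _ hF]
  simp only [smul_eq_mul]
  rw [hs.tsum_prod]
  refine tsum_congr fun a => ?_
  rw [tsum_fintype, mean_eq_sum, Finset.mul_sum]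
  exact Finset.sum_congr rfl fun b _ => by
    rw [jointLaw_apply, ENNReal.toReal_mul, mul_assoc]

/-- Conditioning on the first variable. -/
lemma integral_jointLaw_mul {p : PMF S} {κ : S → PMF T} {G : S → ℝ} {φ : T → ℝ}
    (hG : Integrable (fun c : S × T => G c.1) (jointLaw p κ).toMeasure) :
    ∫ c, G c.1 * φ c.2 ∂(jointLaw p κ).toMeasure =
      ∫ c, G c.1 * mean (κ c.1) φ ∂(jointLaw p κ).toMeasure := by
  obtain ⟨M, hM⟩ : ∃ M, ∀ b, |φ b| ≤ M := by
    obtain ⟨M, hM⟩ := (Set.finite_range fun b => |φ b|).bddAbove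
    exact ⟨M, fun b => hM ⟨b, rfl⟩⟩
  rw [integral_jointLaw (hG.mul_bdd (c := M) (measurable_of_countable _).aestronglyMeasurable
      (Eventually.of_forall fun c => hM c.2)),
    integral_jointLaw (hG.mul_bdd (c := M) (measurable_of_countable _).aestronglyMeasurable
      (Eventually.of_forall fun c => abs_mean_le (κ c.1) hM))]
  refine tsum_congr fun a => ?_
  simp only [mean_const_mul, mean_const]

end Joint

/-! ### The total queue length of an input port -/

section Switch

open MeasureTheory ProbabilityTheory

variable {N : ℕ} {Ω : Type*}

instance : Finite (Schedule N) := by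
  refine Finite.of_injective (β := Pair N → Fin 2)
    (fun s p => ⟨s.1 p, by rcases s.2.1 p with h | h <;> omega⟩) fun s t h => ?_
  refine Subtype.ext (funext fun p => ?_)
  simpa using congrFun h p

/-- The total queue length at input port `i`. -/
def portQueue (i : Fin N) (q : Pair N → ℕ) : ℕ := ∑ j, q (i, j)

lemma portQueue_nextQueue_le (f : Ω → ℕ) (i : Fin N) (q : Pair N → ℕ) (x : Pair N → Ω)
    (s : Schedule N) :
    portQueue i (nextQueue f q x s) ≤ portQueue i q + ∑ j, f (x (i, j)) := by
  rw [portQueue, portQueue, ← Finset.sum_add_distrib]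
  exact Finset.sum_le_sum fun j _ => Nat.sub_le _ _

lemma portQueue_add_le (f : Ω → ℕ) (i : Fin N) (q : Pair N → ℕ) (x : Pair N → Ω)
    (s : Schedule N) :
    portQueue i q + ∑ j, f (x (i, j)) ≤ portQueue i (nextQueue f q x s) + 1 := by
  refine le_trans ?_ (Nat.add_le_add_left (s.2.2.1 i) _)
  rw [portQueue, portQueue, ← Finset.sum_add_distrib, ← Finset.sum_add_distrib]
  exact Finset.sum_le_sum fun j _ => le_tsub_add

lemma meanTotalQueue_eq (μ : PMF (State N Ω)) :
    meanTotalQueue μ = ∑ i, ∑' z, μ z * (portQueue i z.1 : ℝ≥0∞) := by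
  rw [← Summable.tsum_finsetSum fun _ _ => ENNReal.summable, meanTotalQueue]
  refine tsum_congr fun z => ?_
  rw [← Finset.mul_sum, Fintype.sum_prod_type, Nat.cast_sum]
  rfl

variable [Fintype Ω]

lemma map_snd_switchChain (P : Pair N → Ω → PMF Ω) (f : Ω → ℕ) (alg : Scheduler N Ω)
    (z : State N Ω) : (switchChain P f alg z).map Prod.snd = modulatingChain P z.2 := by
  rw [switchChain, PMF.map_bind]
  simp only [PMF.map_comp, Function.comp_def]
  exact (PMF.bind_const _ _).trans (PMF.map_id _)

/-- In steady state the modulating chain has its product stationary law. -/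
lemma map_snd_eq_productLaw {P : Pair N → Ω → PMF Ω} {f : Ω → ℕ} {alg : Scheduler N Ω}
    {π : Pair N → PMF Ω} {μ : PMF (State N Ω)} (hirr : IsIrreducibleChain (modulatingChain P))
    (hπ : ∀ p, IsStationaryLaw (P p) (π p)) (hμ : IsStationaryLaw (switchChain P f alg) μ) :
    μ.map Prod.snd = productLaw π := by
  refine IsStationaryLaw.unique hirr ?_ (isStationaryLaw_productLaw hπ)
  have h := congrArg (PMF.map Prod.snd) hμ
  rw [PMF.map_bind] at h
  simp only [map_snd_switchChain] at h
  rw [IsStationaryLaw, PMF.bind_map]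
  exact h

/-- Under the product stationary law the contributions of distinct pairs are uncorrelated, so
the asymptotic variances of the arrivals at an input port add up. -/
lemma mean_productLaw_sum_sq {P : Pair N → Ω → PMF Ω} (π : Pair N → PMF Ω) (g : Ω → ℝ)
    (i : Fin N) :
    mean (productLaw π) (fun x =>
      (∑ j, (g (x (i, j)) - mean (π (i, j)) g)) ^ 2 +
        2 * ((∑ j, (g (x (i, j)) - mean (π (i, j)) g)) *
          ∑ j, futureBias (P (i, j)) (π (i, j)) g (x (i, j)))) =
      ∑ j, asymptoticVariance (P (i, j)) (π (i, j)) g := by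
  set φ : Fin N → Ω → ℝ := fun j a => g a - mean (π (i, j)) g with hφ
  set ψ : Fin N → Ω → ℝ := fun j a => φ j a + 2 * futureBias (P (i, j)) (π (i, j)) g a with hψ
  have e : ∀ x : Pair N → Ω, (∑ j, φ j (x (i, j))) ^ 2 +
        2 * ((∑ j, φ j (x (i, j))) * ∑ j, futureBias (P (i, j)) (π (i, j)) g (x (i, j))) =
      ∑ j, ∑ l, φ j (x (i, j)) * ψ l (x (i, l)) := by
    intro x
    rw [← Finset.sum_mul_sum]
    simp only [hψ, Finset.sum_add_distrib, ← Finset.mul_sum]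
    ring
  change mean (productLaw π) (fun x => (∑ j, φ j (x (i, j))) ^ 2 +
    2 * ((∑ j, φ j (x (i, j))) * ∑ j, futureBias (P (i, j)) (π (i, j)) g (x (i, j)))) = _
  simp only [e, mean_sum]
  refine Finset.sum_congr rfl fun j _ => ?_
  rw [Finset.sum_eq_single j]
  · rw [mean_productLaw_apply π (i, j) fun a => φ j a * ψ j a, asymptoticVariance]
    congr 1
    funext a
    simp only [hψ, hφ]
    ring
  · intro l _ hl
    rw [mean_productLaw_mul π (i := (i, j)) (j := (i, l)) (by simpa using Ne.symm hl)]
    have : mean (π (i, j)) (φ j) = 0 := by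
      simp only [hφ, mean_sub, mean_const, sub_self]
    rw [this, zero_mul]
  · simp

/-- The steady-state mean queue length at an input port of load `1 - ε` is at least
`(2 ε)⁻¹ (∑ⱼ σⱼ² - O(ε))`, with a constant which depends only on the bounds on the biases. -/
lemma sum_asymptoticVariance_le {P : Pair N → Ω → PMF Ω} {f : Ω → ℕ} {alg : Scheduler N Ω}
    {π : Pair N → PMF Ω} {μ : PMF (State N Ω)} {ε α c : ℝ} (i : Fin N)
    (hirr : IsIrreducibleChain (modulatingChain P))
    (hπ : ∀ p, IsStationaryLaw (P p) (π p)) (hμ : IsStationaryLaw (switchChain P f alg) μ)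
    (hα : 0 ≤ α) (hα' : α < 1)
    (hdecay : ∀ p, HasBiasDecay (P p) (π p) (fun x => (f x : ℝ)) c α)
    (hε : 0 ≤ ε) (hrate : ∑ j, mean (π (i, j)) (fun x => (f x : ℝ)) = 1 - ε)
    (hfin : ∑' z, μ z * (portQueue i z.1 : ℝ≥0∞) ≠ ∞) :
    ∑ j, asymptoticVariance (P (i, j)) (π (i, j)) (fun x => (f x : ℝ)) ≤
      2 * ε * (∑' z, μ z * (portQueue i z.1 : ℝ≥0∞)).toReal +
        ε * (1 + 4 * (N * (c * (1 - α)⁻¹))) := by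
  let _ : MeasurableSpace Ω := ⊤
  let _ : MeasurableSpace (Schedule N) := ⊤
  -- The joint law of the current state, the schedule, and the next modulating state.
  let J := jointLaw (jointLaw μ alg) fun y => modulatingChain P y.1.2
  let next : (State N Ω × Schedule N) × (Pair N → Ω) → State N Ω :=
    fun c => (nextQueue f c.1.1.1 c.1.1.2 c.1.2, c.2)
  have hnow : J.map (fun c => c.1.1) = μ := by
    change J.map (Prod.fst ∘ Prod.fst) = μ
    rw [← PMF.map_comp, jointLaw_map_fst, jointLaw_map_fst]
  have hnext : J.map next = μ := by
    conv_rhs => rw [← show μ.bind (switchChain P f alg) = μ from hμ]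
    simp only [J, jointLaw, PMF.map_bind, PMF.bind_bind, PMF.bind_map, Function.comp_def,
      PMF.map_comp]
    rfl
  have hid : ∀ F : State N Ω → ℝ,
      IdentDistrib (fun c => F c.1.1) (fun c => F (next c)) J.toMeasure J.toMeasure := by
    intro F
    have h : IdentDistrib (fun c : (State N Ω × Schedule N) × (Pair N → Ω) => c.1.1) next
        J.toMeasure J.toMeasure := by
      refine ⟨(measurable_of_countable _).aemeasurable, (measurable_of_countable _).aemeasurable,
        ?_⟩
      rw [PMF.toMeasure_map _ _ (measurable_of_countable _),
        PMF.toMeasure_map _ _ (measurable_of_countable _), hnow, hnext]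
    exact h.comp (measurable_of_countable F)
  have hX : ∀ φ : (Pair N → Ω) → ℝ,
      ∫ c, φ c.1.1.2 ∂J.toMeasure = mean (productLaw π) φ := by
    intro φ
    have h : J.map (fun c => c.1.1.2) = productLaw π := by
      rw [← map_snd_eq_productLaw hirr hπ hμ, ← hnow, PMF.map_comp]
      rfl
    rw [← integral_map (μ := J.toMeasure) (φ := fun c => c.1.1.2) (f := φ)
      (measurable_of_countable _).aemeasurable (measurable_of_countable _).aestronglyMeasurable,
      PMF.toMeasure_map _ _ (measurable_of_countable _), h, PMF.integral_eq_sum]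
    rfl
  let W : State N Ω → ℝ := fun z => (portQueue i z.1 : ℝ)
  let G : (Pair N → Ω) → ℝ := fun x =>
    ∑ j, ((f (x (i, j)) : ℝ) - mean (π (i, j)) fun x => (f x : ℝ))
  let K : (Pair N → Ω) → ℝ := fun x =>
    ∑ j, futureBias (P (i, j)) (π (i, j)) (fun x => (f x : ℝ)) (x (i, j))
  have hGeq : ∀ x, G x = ((∑ j, f (x (i, j)) : ℕ) : ℝ) - 1 + ε := by
    intro x
    simp only [G, Finset.sum_sub_distrib, hrate]
    push_cast
    ring
  have hKB : ∀ x, |K x| ≤ N * (c * (1 - α)⁻¹) := by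
    intro x
    refine (Finset.abs_sum_le_sum_abs _ _).trans ?_
    refine (Finset.sum_le_sum fun j _ => (hdecay (i, j)).abs_futureBias_le hα hα' _).trans ?_
    simp
  have hPoisson : ∀ x, mean (modulatingChain P x) (fun y => G y + K y) = K x := by
    intro x
    have e : (fun y => G y + K y) = fun y => ∑ j, (((f (y (i, j)) : ℝ) -
        mean (π (i, j)) fun x => (f x : ℝ)) +
          futureBias (P (i, j)) (π (i, j)) (fun x => (f x : ℝ)) (y (i, j))) := by
      funext y
      simp only [G, K, Finset.sum_add_distrib]
    rw [e, mean_sum]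
    refine Finset.sum_congr rfl fun j _ => ?_
    rw [← (hdecay (i, j)).mean_add_futureBias hα hα' (x (i, j))]
    exact mean_productLaw_apply (fun p => P p (x p)) (i, j) fun a => ((f a : ℝ) -
        mean (π (i, j)) fun x => (f x : ℝ)) +
          futureBias (P (i, j)) (π (i, j)) (fun x => (f x : ℝ)) a
  have hlint : ∑' z, μ z * (portQueue i z.1 : ℝ≥0∞) = ∫⁻ z, ‖W z‖ₑ ∂μ.toMeasure := by
    rw [lintegral_countable']
    refine tsum_congr fun z => ?_
    rw [PMF.toMeasure_apply_singleton _ _ (measurableSet_singleton z), mul_comm]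
    simp [W]
  have hWμ : Integrable W μ.toMeasure :=
    ⟨(measurable_of_countable _).aestronglyMeasurable, by
      rw [HasFiniteIntegral, ← hlint]; exact hfin.lt_top⟩
  have hWi : Integrable (fun c => W c.1.1) J.toMeasure := by
    rw [← hnow, ← PMF.toMeasure_map _ _ (measurable_of_countable _)] at hWμ
    exact hWμ.comp_measurable (measurable_of_countable _)
  have hWint : ∫ c, W c.1.1 ∂J.toMeasure = (∑' z, μ z * (portQueue i z.1 : ℝ≥0∞)).toReal := by
    rw [hlint, ← integral_norm_eq_lintegral_enorm hWμ.aestronglyMeasurable]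
    conv_rhs => rw [← hnow, ← PMF.toMeasure_map _ _ (measurable_of_countable _)]
    rw [integral_map (measurable_of_countable _).aemeasurable
      (measurable_of_countable _).aestronglyMeasurable]
    exact integral_congr_ae (Eventually.of_forall fun c =>
      (Real.norm_of_nonneg (by positivity)).symm)
  obtain ⟨D, hD⟩ : ∃ D, ∀ x, |G x| ≤ D := by
    obtain ⟨D, hD⟩ := (Set.finite_range fun x => |G x|).bddAbove
    exact ⟨D, fun x => hD ⟨x, rfl⟩⟩
  have hGm : ∫ c, G c.1.1.2 ∂J.toMeasure = 0 := by
    rw [hX G]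
    simp only [G, mean_sum]
    refine Finset.sum_eq_zero fun j _ => ?_
    rw [mean_productLaw_apply π (i, j)
      (fun a => (f a : ℝ) - mean (π (i, j)) fun x => (f x : ℝ)), mean_sub, mean_const, sub_self]
  -- By the Poisson equation `E[W' K(X)] = E[W' (G + K)(X')]`, and by stationarity the latter
  -- is `E[W (G + K)(X)]`.
  have hcorr : ∫ c, W (next c) * K c.1.1.2 ∂J.toMeasure =
      ∫ c, W c.1.1 * (G c.1.1.2 + K c.1.1.2) ∂J.toMeasure := by
    rw [(hid fun z => W z * (G z.2 + K z.2)).integral_eq]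
    have h := integral_jointLaw_mul (p := jointLaw μ alg)
      (κ := fun y => modulatingChain P y.1.2)
      (G := fun y => (portQueue i (nextQueue f y.1.1 y.1.2 y.2) : ℝ)) (φ := fun x => G x + K x)
      ((hid W).integrable_iff.1 hWi)
    simp only [hPoisson] at h
    exact h.symm
  have key := integral_sq_add_le_of_stationary_queue (ρ := J.toMeasure)
    (W := fun c => W c.1.1) (W' := fun c => W (next c)) (G := fun c => G c.1.1.2)
    (K := fun c => K c.1.1.2) (ε := ε) (B := N * (c * (1 - α)⁻¹)) (D := D)
    (measurable_of_countable _) (measurable_of_countable _) hε (hid W) hWi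
    (fun c => Nat.cast_nonneg _)
    (fun c => by
      have := Nat.cast_le (α := ℝ).2 (portQueue_add_le f i c.1.1.1 c.1.1.2 c.1.2)
      rw [hGeq]
      push_cast at this ⊢
      simp only [W, next]
      linarith)
    (fun c => by
      have := Nat.cast_le (α := ℝ).2 (portQueue_nextQueue_le f i c.1.1.1 c.1.1.2 c.1.2)
      rw [hGeq]
      push_cast at this ⊢
      simp only [W, next]
      linarith)
    (fun c => hD _) (fun c => hKB _) hGm hcorr
  rw [hWint, hX fun x => G x ^ 2 + 2 * (G x * K x)] at key
  rw [← mean_productLaw_sum_sq]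
  exact key

/-- The steady-state lower bound on the mean total queue length for a fixed `ε`. -/
lemma ofReal_le_mul_meanTotalQueue {P : Pair N → Ω → PMF Ω} {f : Ω → ℕ} {alg : Scheduler N Ω}
    {π : Pair N → PMF Ω} {μ : PMF (State N Ω)} {ε α c : ℝ}
    (hirr : IsIrreducibleChain (modulatingChain P))
    (hπ : ∀ p, IsStationaryLaw (P p) (π p)) (hμ : IsStationaryLaw (switchChain P f alg) μ)
    (hα : 0 ≤ α) (hα' : α < 1)
    (hdecay : ∀ p, HasBiasDecay (P p) (π p) (fun x => (f x : ℝ)) c α)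
    (hε : 0 < ε) (hrate : ∀ i, ∑ j, mean (π (i, j)) (fun x => (f x : ℝ)) = 1 - ε) :
    ENNReal.ofReal ((∑ p, asymptoticVariance (P p) (π p) (fun x => (f x : ℝ)) -
        ε * (N * (1 + 4 * (N * (c * (1 - α)⁻¹))))) / 2) ≤
      ENNReal.ofReal ε * meanTotalQueue μ := by
  by_cases htop : meanTotalQueue μ = ∞
  · rw [htop, ENNReal.mul_top (by simpa using hε)]
    exact le_top
  have hfin : ∀ i, ∑' z, μ z * (portQueue i z.1 : ℝ≥0∞) ≠ ∞ := by
    rw [meanTotalQueue_eq] at htop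
    exact fun i => ENNReal.sum_ne_top.1 htop i (Finset.mem_univ i)
  have hsum : (meanTotalQueue μ).toReal =
      ∑ i, (∑' z, μ z * (portQueue i z.1 : ℝ≥0∞)).toReal := by
    rw [meanTotalQueue_eq, ENNReal.toReal_sum fun i _ => hfin i]
  rw [← ENNReal.ofReal_toReal htop, ← ENNReal.ofReal_mul hε.le, hsum]
  refine ENNReal.ofReal_le_ofReal ?_
  have := Finset.sum_le_sum fun i (_ : i ∈ Finset.univ) =>
    sum_asymptoticVariance_le i hirr hπ hμ hα hα' hdecay hε.le (hrate i) (hfin i)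
  rw [← Fintype.sum_prod_type', Finset.sum_add_distrib, ← Finset.mul_sum] at this
  simp only [Finset.sum_const, Finset.card_univ, Fintype.card_fin, nsmul_eq_mul] at this
  linarith

end Switch

/-! ### Heavy traffic limits -/

lemma abs_sub_mean_le {S : Type*} [Fintype S] (π : PMF S) {g : S → ℝ} (hg : ∀ x, 0 ≤ g x)
    (x : S) : |g x - mean π g| ≤ ⨆ y, g y := by
  have hL : ∀ y, g y ≤ ⨆ y, g y := fun y => le_ciSup (Set.finite_range g).bddAbove y
  have h0 : 0 ≤ mean π g := by simpa [mean_const] using mean_mono π (g := fun _ => 0) hg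
  have h1 : mean π g ≤ ⨆ y, g y := by
    simpa only [mean_const] using mean_mono π (h := fun _ => ⨆ y, g y) hL
  rw [abs_le]
  constructor <;> linarith [hL x, hg x]

/-- Under uniform decay of the biases the autocovariances are dominated by a geometric series, so
the asymptotic variances converge to the sum of the limits of the autocovariances. -/
lemma tendsto_asymptoticVariance {S : Type*} [Fintype S] {P : ℝ → S → PMF S} {π : ℝ → PMF S}
    {g : S → ℝ} {γ : ℕ → ℝ} {α c L : ℝ} (hα : 0 ≤ α) (hα' : α < 1) {l : Filter ℝ} [l.NeBot]
    (hγ : ∀ t, Tendsto (fun ε => autocov (P ε) (π ε) g t) l (𝓝 (γ t)))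
    (hL : ∀ ε x, |g x - mean (π ε) g| ≤ L) (h : ∀ᶠ ε in l, HasBiasDecay (P ε) (π ε) g c α) :
    Summable (fun t => γ (t + 1)) ∧
      Tendsto (fun ε => asymptoticVariance (P ε) (π ε) g) l
        (𝓝 (γ 0 + 2 * ∑' t, γ (t + 1))) := by
  have hb : ∀ᶠ ε in l, ∀ t, ‖autocov (P ε) (π ε) g (t + 1)‖ ≤ L * c * α ^ t := by
    filter_upwards [h] with ε hε t using abs_autocov_succ_le hε (hL ε) t
  have hs : Summable fun t : ℕ => L * c * α ^ t := summable_geometric_bound hα hα'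
  refine ⟨Summable.of_norm_bounded hs fun t =>
    le_of_tendsto (hγ (t + 1)).norm (hb.mono fun ε hε => hε t), ?_⟩
  have := (hγ 0).add
    ((tendsto_tsum_of_dominated_convergence hs (fun t => hγ (t + 1)) hb).const_mul 2)
  refine this.congr' ?_
  filter_upwards [h] with ε hε using (asymptoticVariance_eq hε hα hα').symm

lemma tendsto_sum_Icc_one {γ : ℕ → ℝ} (h : Summable fun t => γ (t + 1)) :
    Tendsto (fun m : ℕ => ∑ t ∈ Finset.Icc 1 m, γ t) atTop (𝓝 (∑' t, γ (t + 1))) := by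
  refine h.hasSum.tendsto_sum_nat.congr fun m => ?_
  induction m with
  | zero => rfl
  | succ m ih => rw [Finset.sum_range_succ, Finset.sum_Icc_succ_top (Nat.le_add_left 1 m), ih]

end MarkovSwitch

open MarkovSwitch in
theorem mainTheorem5 {N : ℕ} {Ω : Type*} [Fintype Ω]
    -- arrivals, and the limiting rate matrix on the saturated face with positive entries
    (f : Ω → ℕ)
    (v : Pair N → ℝ) (hv_pos : ∀ p, 0 < v p)
    (hv_row : ∀ i, ∑ j, v (i, j) = 1) (hv_col : ∀ j, ∑ i, v (i, j) = 1)
    -- for each `ε`, independent modulating chains and their stationary laws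
    (P : ℝ → Pair N → Ω → PMF Ω) (π : ℝ → Pair N → PMF Ω)
    (hirr : ∀ ε ∈ Set.Ioo (0 : ℝ) 1, IsIrreducibleChain (modulatingChain (P ε)))
    (haper : ∀ ε ∈ Set.Ioo (0 : ℝ) 1, IsAperiodicChain (modulatingChain (P ε)))
    (hstat : ∀ ε ∈ Set.Ioo (0 : ℝ) 1, ∀ p, IsStationaryLaw (P ε p) (π ε p))
    (hrate : ∀ ε ∈ Set.Ioo (0 : ℝ) 1, ∀ p, mean (π ε p) (fun x => (f x : ℝ)) = (1 - ε) * v p)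
    -- convergence of the autocovariances
    (γ : Pair N → ℕ → ℝ)
    (hγ : ∀ p t, Tendsto (fun ε : ℝ => autocov (P ε p) (π ε p) (fun x => (f x : ℝ)) t)
      (𝓝[>] 0) (𝓝 (γ p t)))
    -- uniform geometric mixing
    (α C : ℝ) (hα_pos : 0 < α) (hα_lt : α < 1) (hC : 0 < C)
    (hmix : ∀ ε ∈ Set.Ioo (0 : ℝ) 1, ∀ p,
      IsGeomMixing (P ε p) (π ε p) (fun x => (f x : ℝ)) α C)
    -- a scheduling algorithm under which the switch is stable, and the steady-state law
    (alg : ℝ → Scheduler N Ω) (z₀ : ℝ → State N Ω) (μ : ℝ → PMF (State N Ω))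
    (hstable : ∀ ε ∈ Set.Ioo (0 : ℝ) 1,
      IsPositiveRecurrentAt (switchChain (P ε) f (alg ε)) (z₀ ε))
    (hsteady : ∀ ε ∈ Set.Ioo (0 : ℝ) 1,
      ConvergesInLaw (switchChain (P ε) f (alg ε)) (z₀ ε) (μ ε)) :
    ∃ σ : Pair N → ℝ,
      (∀ p, Tendsto (fun m : ℕ => γ p 0 + 2 * ∑ t ∈ Finset.Icc 1 m, γ p t) atTop
        (𝓝 (σ p ^ 2))) ∧
      ENNReal.ofReal ((∑ p, σ p ^ 2) / 2) ≤
        liminf (fun ε : ℝ => ENNReal.ofReal ε * meanTotalQueue (μ ε)) (𝓝[>] 0) := by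
  have hev : ∀ᶠ ε : ℝ in 𝓝[>] 0, ε ∈ Set.Ioo (0 : ℝ) 1 :=
    Ioo_mem_nhdsGT zero_lt_one
  have hdecay := fun ε hε p => (hmix ε hε p).hasBiasDecay
  have hvar := fun p => tendsto_asymptoticVariance (P := fun ε => P ε p) (π := fun ε => π ε p)
    hα_pos.le hα_lt (hγ p) (fun ε => abs_sub_mean_le (π ε p) fun x => Nat.cast_nonneg (f x))
    (hev.mono fun ε hε => hdecay ε hε p)
  have hnonneg : ∀ p, 0 ≤ γ p 0 + 2 * ∑' t, γ p (t + 1) := fun p =>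
    ge_of_tendsto (hvar p).2 (hev.mono fun ε hε =>
      asymptoticVariance_nonneg (hdecay ε hε p) hα_pos.le hα_lt (hstat ε hε p))
  refine ⟨fun p => √(γ p 0 + 2 * ∑' t, γ p (t + 1)), fun p => ?_, ?_⟩
  · rw [Real.sq_sqrt (hnonneg p)]
    exact ((tendsto_sum_Icc_one (hvar p).1).const_mul 2).const_add _
  simp only [Real.sq_sqrt (hnonneg _)]
  have hε0 : Tendsto (fun ε : ℝ => ε) (𝓝[>] 0) (𝓝 0) :=
    tendsto_nhdsWithin_of_tendsto_nhds tendsto_id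
  have hlim := ENNReal.tendsto_ofReal (((tendsto_finsetSum Finset.univ fun p _ => (hvar p).2).sub
    (hε0.mul_const (N * (1 + 4 * (N * (2 * (⨆ x, (f x : ℝ)) * C * α * (1 - α)⁻¹)))))).div_const 2)
  rw [zero_mul, sub_zero] at hlim
  rw [← hlim.liminf_eq]
  refine liminf_le_liminf ?_
  filter_upwards [hev] with ε hε
  refine ofReal_le_mul_meanTotalQueue (hirr ε hε) (hstat ε hε)
    (hsteady ε hε).isStationaryLaw hα_pos.le hα_lt (hdecay ε hε) hε.1 fun i => ?_
  simp only [hrate ε hε, ← Finset.mul_sum, hv_row i, mul_one]
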